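/- Let $(M_1,g_1)$ and $(M_2,g_2)$ be connected smooth Riemannian manifolds without boundary, and let $(M,g)=(M_1\times M_2,\,g_1\oplus g_2)$ be their Riemannian product. For a Riemannian manifold $(N,h)$, write $\nabla^2f=\nabla\nabla f$ for the Hessian of a smooth function $f$ and $\mathrm{Ric}$ for the Ricci tensor, both seen as $(1,1)$-tensor fields, and let $$W(N,h)=\{f\in C^\infty(N,\mathbb{R}) : \nabla^2f=-f\cdot\mathrm{Ric}\}$$ be the real vector space of smooth solutions of the generalised Ricci-Hessian equation. Assume that the Ricci tensor $\mathrm{Ric}_{M_2}$ of $(M_2,g_2)$ does not vanish identically. Then: 1. A function $f\in C^\infty(M,\mathbb{R})$ that is not identically zero satisfies $\nabla^2f=-f\cdot\mathrm{Ric}$ on $(M,g)$ if and only if $\mathrm{Ric}_{M_1}=0$ identically, $f$ depends only on $M_2$, i.e. $f(x_1,x_2)=h(x_2)$ for some $h\in C^\infty(M_2,\mathbb{R})$, and $h$ satisfies $\nabla^2h=-h\cdot\mathrm{Ric}_{M_2}$ on $(M_2,g_2)$. 2. Extending functions trivially along $M_1$, $h\mapsto\big((x_1,x_2)\mapsto h(x_2)\big)$,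 defines an isomorphism of real vector spaces $W(M_2,g_2)\to W(M,g)$ if and only if $\mathrm{Ric}_{M_1}=0$ or $W(M_2,g_2)=\{0\}$. In particular it is an isomorphism whenever $\mathrm{Ric}_{M_1}=0$. -/

import Mathlib

open scoped Manifold ContDiff

namespace RicciHessian

open ContinuousLinearMap
open scoped Topology

set_option maxSynthPendingDepth 3

/-! ### Riemannian geometry of a metric on an open subset of a vector space

Here `G : E → E →L[ℝ] E →L[ℝ] ℝ` is a field of bilinear forms on a finite-dimensional real vector
space `E`; it is a Riemannian metric on the open set in which it is smooth and positive definite,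
and vector fields are maps `E → E`. -/

section Local

variable {E : Type*} [NormedAddCommGroup E] [NormedSpace ℝ E]

/-- The form `(u, v, w) ↦ ½ (∂ᵤ G(v, w) + ∂ᵥ G(u, w) - ∂_w G(u, v))` at the point `y`
(Christoffel symbols of the first kind). -/
noncomputable def koszul (G : E → E →L[ℝ] E →L[ℝ] ℝ) (y : E) : E →L[ℝ] E →L[ℝ] E →L[ℝ] ℝ :=
  let D : E →L[ℝ] E →L[ℝ] E →L[ℝ] ℝ := fderiv ℝ G y
  (2⁻¹ : ℝ) • (D + D.flip - ((flipₗᵢ ℝ E E ℝ).toContinuousLinearEquiv : (E →L[ℝ] E →L[ℝ] ℝ) →L[ℝ] E →L[ℝ] E →L[ℝ] ℝ) ∘L D.flip)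

theorem koszul_apply (G : E → E →L[ℝ] E →L[ℝ] ℝ) (y u v w : E) :
    koszul G y u v w
      = 2⁻¹ * (fderiv ℝ G y u v w + fderiv ℝ G y v u w - fderiv ℝ G y w u v) := by
  simp [koszul]

/-- The Christoffel symbols `Γ(u, v)` of the second kind:
`G(Γ(u, v), w) = ½ (∂ᵤ G(v, w) + ∂ᵥ G(u, w) - ∂_w G(u, v))` for all `w`. -/
noncomputable def christoffel (G : E → E →L[ℝ] E →L[ℝ] ℝ) (y : E) : E →L[ℝ] E →L[ℝ] E :=
  (compL ℝ E (E →L[ℝ] ℝ) E (G y).inverse) ∘L (koszul G y)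

theorem christoffel_apply (G : E → E →L[ℝ] E →L[ℝ] ℝ) (y u v : E) :
    christoffel G y u v = (G y).inverse (koszul G y u v) := by
  simp [christoffel]

/-- The Levi-Civita covariant derivative `u ↦ ∇ᵤ X = ∂ᵤ X + Γ(u, X)` of a vector field `X`. -/
noncomputable def covDeriv (G : E → E →L[ℝ] E →L[ℝ] ℝ) (X : E → E) (y : E) : E →L[ℝ] E :=
  fderiv ℝ X y + (christoffel G y).flip (X y)

/-- The gradient vector field of a function: `G(∇F, w) = ∂_w F` for all `w`. -/
noncomputable def gradient (G : E → E →L[ℝ] E →L[ℝ] ℝ) (F : E → ℝ) (y : E) : E :=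
  (G y).inverse (fderiv ℝ F y)

/-- The linear map `u ↦ R(u, v) w`, where `R(u, v) w = ∇ᵤ ∇ᵥ w - ∇ᵥ ∇ᵤ w` for constant vector
fields `u, v, w`, that is,
`R(u, v) w = (∂ᵤ Γ)(v, w) - (∂ᵥ Γ)(u, w) + Γ(u, Γ(v, w)) - Γ(v, Γ(u, w))`. -/
noncomputable def curvature (G : E → E →L[ℝ] E →L[ℝ] ℝ) (y v w : E) : E →L[ℝ] E :=
  let Γ : E →L[ℝ] E →L[ℝ] E := christoffel G y
  let DΓ : E →L[ℝ] E →L[ℝ] E →L[ℝ] E := fderiv ℝ (christoffel G) y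
  (DΓ.flip v).flip w - (DΓ v).flip w + Γ.flip (Γ v w) - (Γ v) ∘L (Γ.flip w)

theorem curvature_apply (G : E → E →L[ℝ] E →L[ℝ] ℝ) (y u v w : E) :
    curvature G y v w u
      = fderiv ℝ (christoffel G) y u v w - fderiv ℝ (christoffel G) y v u w
        + christoffel G y u (christoffel G y v w) - christoffel G y v (christoffel G y u w) := by
  simp [curvature]

variable [FiniteDimensional ℝ E]

/-- The Ricci tensor as a bilinear form, `ric(v, w) = tr (u ↦ R(u, v) w)`. -/
noncomputable def ricciForm (G : E → E →L[ℝ] E →L[ℝ] ℝ) (y : E) : E →ₗ[ℝ] E →ₗ[ℝ] ℝ :=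
  LinearMap.mk₂ ℝ (fun v w => LinearMap.trace ℝ E (curvature G y v w : E →ₗ[ℝ] E))
    (fun v v' w => by
      rw [← map_add]; congr 1; ext u; simp [curvature]; abel)
    (fun c v w => by
      rw [← map_smul]; congr 1; ext u; simp [curvature, smul_sub, smul_add])
    (fun v w w' => by
      rw [← map_add]; congr 1; ext u; simp [curvature]; abel)
    (fun c v w => by
      rw [← map_smul]; congr 1; ext u; simp [curvature, smul_sub, smul_add])

/-- The Ricci tensor as an endomorphism field: `G(Ric v, w) = ric(v, w)` for all `w`. -/
noncomputable def ricciEndo (G : E → E →L[ℝ] E →L[ℝ] ℝ) (y : E) : E →L[ℝ] E :=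
  (G y).inverse ∘L
    LinearMap.toContinuousLinearMap
      ((LinearMap.toContinuousLinearMap : (E →ₗ[ℝ] ℝ) ≃ₗ[ℝ] (E →L[ℝ] ℝ)).toLinearMap
        ∘ₗ ricciForm G y)

end Local

/-! ### Riemannian manifolds -/

section Manifold

variable {E : Type*} [NormedAddCommGroup E] [NormedSpace ℝ E]
  {H : Type*} [TopologicalSpace H] (I : ModelWithCorners ℝ E H)
  (M : Type*) [TopologicalSpace M] [ChartedSpace H M] [IsManifold I ∞ M]

/-- Smooth Riemannian metrics on `M`. -/
abbrev Metric := Bundle.ContMDiffRiemannianMetric I ∞ E (fun x : M => TangentSpace I x)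

variable {I M}

/-- The scalar product on `T_p M`, which in Mathlib is a copy of the model space `E`, identified
with `T_p M` through the chart `extChartAt I p` around `p`. -/
def formAt (g : Metric I M) (p : M) : E →L[ℝ] E →L[ℝ] ℝ := g.inner p


/-- The expression `((dψ)(y)^* g) : E × E → ℝ` of the metric at the point `y` of the chart around
`x`, where `ψ = (extChartAt I x).symm` is the inverse of this chart. -/
noncomputable def chartMetric (g : Metric I M) (x : M) (y : E) : E →L[ℝ] E →L[ℝ] ℝ :=
  let A : E →L[ℝ] E := mfderiv 𝓘(ℝ, E) I (extChartAt I x).symm y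
  (formAt g ((extChartAt I x).symm y)).bilinearComp A A

theorem inCoordinates_bilin (x p : M) (hp : p ∈ (chartAt H x).source)
    (φ : TangentSpace I p →L[ℝ] TangentSpace I p →L[ℝ] ℝ) (v w : E) :
    inCoordinates E (fun q : M => TangentSpace I q) (E →L[ℝ] ℝ)
        (fun q : M => TangentSpace I q →L[ℝ] ℝ) x p x p φ v w
      = φ ((trivializationAt E (TangentSpace I) x).symmL ℝ p v)
          ((trivializationAt E (TangentSpace I) x).symmL ℝ p w) := by
  rw [inCoordinates_apply_eq₂ (𝕜 := ℝ) (E₃ := fun _ : M => ℝ) (F₃ := ℝ) (F₁ := E) (F₂ := E)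
    (x₀ := x) (x := p) (E₁ := fun q : M => TangentSpace I q)
    (E₂ := fun q : M => TangentSpace I q) (ϕ := φ) (v := v) (w := w)
    (by simpa using hp) (by simpa using hp) (by simp)]
  rw [Bundle.Trivialization.symmL_apply _ (by simpa using hp),
    Bundle.Trivialization.symmL_apply _ (by simpa using hp)]
  simp

theorem chartMetric_apply (g : Metric I M) (x : M) (y v w : E) :
    chartMetric g x y v w = formAt g ((extChartAt I x).symm y)
      (mfderiv 𝓘(ℝ, E) I (extChartAt I x).symm y v)
      (mfderiv 𝓘(ℝ, E) I (extChartAt I x).symm y w) := rfl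

/-- The Hessian `∇²f = ∇∇f` at `x`, as an endomorphism of the tangent space: the Levi-Civita
covariant derivative `u ↦ ∇ᵤ (∇f)` of the gradient field. It is computed in the chart around `x`,
whose derivative at `x` is the identity of `T_x M = E` (`mfderiv_extChartAt_self`). -/
noncomputable def hessian (g : Metric I M) (f : M → ℝ) (x : M) :
    TangentSpace I x →L[ℝ] TangentSpace I x :=
  (covDeriv (chartMetric g x) (gradient (chartMetric g x) (f ∘ (extChartAt I x).symm))
    (extChartAt I x x) : E →L[ℝ] E)

theorem hessian_smul (g : Metric I M) (c : ℝ) (f : M → ℝ) (x : M) :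
    hessian g (c • f) x = c • hessian g f x := by
  have key : gradient (chartMetric g x) ((c • f) ∘ (extChartAt I x).symm)
      = c • gradient (chartMetric g x) (f ∘ (extChartAt I x).symm) := by
    ext z
    have e : (c • f) ∘ (extChartAt I x).symm = c • (f ∘ (extChartAt I x).symm) := rfl
    rw [Pi.smul_apply, gradient, gradient, e, fderiv_const_smul_field, Pi.smul_apply, map_smul]
  unfold hessian covDeriv
  rw [key, fderiv_const_smul_field, Pi.smul_apply, Pi.smul_apply, map_smul]
  exact (smul_add _ _ _).symm

variable [I.Boundaryless]

theorem chartMetric_eq (g : Metric I M) (x : M) {y : E} (hy : y ∈ (extChartAt I x).target) :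
    chartMetric g x y = inCoordinates E (fun q : M => TangentSpace I q) (E →L[ℝ] ℝ)
        (fun q : M => TangentSpace I q →L[ℝ] ℝ) x ((extChartAt I x).symm y) x
        ((extChartAt I x).symm y) (g.inner ((extChartAt I x).symm y)) := by
  have hp : (extChartAt I x).symm y ∈ (chartAt H x).source := by
    simpa using (extChartAt I x).map_target hy
  ext v w
  rw [inCoordinates_bilin x _ hp, TangentBundle.symmL_trivializationAt hp,
    (extChartAt I x).right_inv hy, I.range_eq_univ, mfderivWithin_univ]
  rfl

theorem contDiffAt_chartMetric (g : Metric I M) (x : M) {y : E}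
    (hy : y ∈ (extChartAt I x).target) : ContDiffAt ℝ ∞ (chartMetric g x) y := by
  have hnhds : (extChartAt I x).target ∈ 𝓝 y := (isOpen_extChartAt_target x).mem_nhds hy
  have h1 : ContMDiffAt I (I.prod 𝓘(ℝ, E →L[ℝ] E →L[ℝ] ℝ)) ∞ (fun b =>
    Bundle.TotalSpace.mk' (E →L[ℝ] E →L[ℝ] ℝ)
      (E := fun b : M => TangentSpace I b →L[ℝ] TangentSpace I b →L[ℝ] ℝ) b (g.inner b))
      ((extChartAt I x).symm y) := g.contMDiff.contMDiffAt
  have hp : (extChartAt I x).symm y ∈ (chartAt H x).source := by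
    simpa using (extChartAt I x).map_target hy
  have h2 := ((Bundle.Trivialization.contMDiffAt_iff (IB := I) (n := ∞) 
    (e := trivializationAt (E →L[ℝ] E →L[ℝ] ℝ)
      (fun b : M => TangentSpace I b →L[ℝ] TangentSpace I b →L[ℝ] ℝ) x) (by
      simpa using hp)).1 h1).2
  have h3 := h2.comp y (contMDiffOn_extChartAt_symm (n := ∞) x |>.contMDiffAt hnhds)
  rw [← contMDiffAt_iff_contDiffAt]
  refine h3.congr_of_eventuallyEq ?_
  filter_upwards [hnhds] with z hz
  exact chartMetric_eq g x hz

theorem isInvertible_chartMetric [FiniteDimensional ℝ E] (g : Metric I M) (x : M) {y : E}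
    (hy : y ∈ (extChartAt I x).target) : (chartMetric g x y).IsInvertible := by
  have hp : (extChartAt I x).symm y ∈ (chartAt H x).source := by
    simpa using (extChartAt I x).map_target hy
  have hinv := isInvertible_mfderivWithin_extChartAt_symm (I := I) hy
  rw [I.range_eq_univ, mfderivWithin_univ] at hinv
  have hinj : Function.Injective (chartMetric g x y) := by
    rw [injective_iff_map_eq_zero]
    intro v hv
    by_contra hne
    have h0 : chartMetric g x y v v = 0 := by rw [hv]; rfl
    refine (g.pos ((extChartAt I x).symm y)
      (mfderiv 𝓘(ℝ, E) I (extChartAt I x).symm y v) ?_).ne' h0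
    intro h
    exact hne (hinv.injective (h.trans (map_zero _).symm))
  have hdim : Module.finrank ℝ E = Module.finrank ℝ (E →L[ℝ] ℝ) := by
    rw [← LinearEquiv.finrank_eq (LinearMap.toContinuousLinearMap : (E →ₗ[ℝ] ℝ) ≃ₗ[ℝ] _)]
    exact (Subspace.dual_finrank_eq (K := ℝ) (V := E)).symm
  exact ⟨(LinearEquiv.ofInjectiveOfFinrankEq (chartMetric g x y : E →ₗ[ℝ] E →L[ℝ] ℝ)
    hinj hdim).toContinuousLinearEquiv, by ext; rfl⟩

theorem contDiffAt_comp_symm {f : M → ℝ} (hf : ContMDiff I 𝓘(ℝ, ℝ) ∞ f) (x : M) {y : E}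
    (hy : y ∈ (extChartAt I x).target) : ContDiffAt ℝ ∞ (f ∘ (extChartAt I x).symm) y := by
  rw [← contMDiffAt_iff_contDiffAt]
  exact hf.contMDiffAt.comp y ((contMDiffOn_extChartAt_symm (n := ∞) x).contMDiffAt
    ((isOpen_extChartAt_target x).mem_nhds hy))

variable [FiniteDimensional ℝ E]

/-- The Ricci tensor at `x`, as an endomorphism of the tangent space, computed in the chart
around `x`. -/
noncomputable def ricci (g : Metric I M) (x : M) : TangentSpace I x →L[ℝ] TangentSpace I x :=
  (ricciEndo (chartMetric g x) (extChartAt I x x) : E →L[ℝ] E)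

/-- The generalised Ricci-Hessian equation `∇²f = -f · Ric`. -/
def IsSolution (g : Metric I M) (f : M → ℝ) : Prop :=
  ∀ x : M, hessian g f x = -(f x) • ricci g x

theorem differentiableAt_gradient (g : Metric I M) {f : M → ℝ} (hf : ContMDiff I 𝓘(ℝ, ℝ) ∞ f)
    (x : M) {y : E} (hy : y ∈ (extChartAt I x).target) :
    DifferentiableAt ℝ (gradient (chartMetric g x) (f ∘ (extChartAt I x).symm)) y := by
  have h1 : DifferentiableAt ℝ (fun z => (chartMetric g x z).inverse) y :=
    (((isInvertible_chartMetric g x hy).contDiffAt_map_inverse (n := ∞)).comp y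
      (contDiffAt_chartMetric g x hy)).differentiableAt (by simp)
  have h2 : DifferentiableAt ℝ (fderiv ℝ (f ∘ (extChartAt I x).symm)) y :=
    ((contDiffAt_comp_symm hf x hy).fderiv_right (m := 1) (by norm_cast)).differentiableAt
      (by simp)
  exact h1.clm_apply h2

theorem hessian_add (g : Metric I M) {f f' : M → ℝ} (hf : ContMDiff I 𝓘(ℝ, ℝ) ∞ f)
    (hf' : ContMDiff I 𝓘(ℝ, ℝ) ∞ f') (x : M) :
    hessian g (f + f') x = hessian g f x + hessian g f' x := by
  have hx : extChartAt I x x ∈ (extChartAt I x).target := mem_extChartAt_target x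
  have key : gradient (chartMetric g x) ((f + f') ∘ (extChartAt I x).symm)
      =ᶠ[𝓝 (extChartAt I x x)] gradient (chartMetric g x) (f ∘ (extChartAt I x).symm)
        + gradient (chartMetric g x) (f' ∘ (extChartAt I x).symm) := by
    filter_upwards [(isOpen_extChartAt_target x).mem_nhds hx] with z hz
    have e : (f + f') ∘ (extChartAt I x).symm
      = f ∘ (extChartAt I x).symm + f' ∘ (extChartAt I x).symm := rfl
    rw [Pi.add_apply, gradient, gradient, gradient, e, fderiv_add
      ((contDiffAt_comp_symm hf x hz).differentiableAt (by simp))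
      ((contDiffAt_comp_symm hf' x hz).differentiableAt (by simp)), map_add]
  unfold hessian covDeriv
  rw [key.fderiv_eq, key.eq_of_nhds, fderiv_add (differentiableAt_gradient g hf x hx)
    (differentiableAt_gradient g hf' x hx), Pi.add_apply, map_add]
  exact add_add_add_comm _ _ _ _

/-- The real vector space `W(M, g)` of the smooth solutions of `∇²f = -f · Ric`. -/
noncomputable def W (g : Metric I M) : Submodule ℝ C^∞⟮I, M; ℝ⟯ where
  carrier := {f | IsSolution g f}
  add_mem' {f f'} hf hf' x := by
    have h := hessian_add g f.contMDiff f'.contMDiff x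
    rw [hf x, hf' x] at h
    rw [ContMDiffMap.coe_add, h, Pi.add_apply, neg_add, add_smul]
  zero_mem' x := by
    have h := hessian_smul g 0 (0 : M → ℝ) x
    rw [zero_smul, zero_smul] at h
    rw [ContMDiffMap.coe_zero, h]
    simp
  smul_mem' c f hf x := by
    rw [ContMDiffMap.coe_smul, hessian_smul, hf x, Pi.smul_apply, smul_smul, smul_eq_mul, mul_neg]

end Manifold

/-! ### Riemannian products -/

section Product

variable
  {E₁ : Type*} [NormedAddCommGroup E₁] [NormedSpace ℝ E₁]
  {H₁ : Type*} [TopologicalSpace H₁] {I₁ : ModelWithCorners ℝ E₁ H₁}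
  {M₁ : Type*} [TopologicalSpace M₁] [ChartedSpace H₁ M₁] [IsManifold I₁ ∞ M₁]
  {E₂ : Type*} [NormedAddCommGroup E₂] [NormedSpace ℝ E₂]
  {H₂ : Type*} [TopologicalSpace H₂] {I₂ : ModelWithCorners ℝ E₂ H₂}
  {M₂ : Type*} [TopologicalSpace M₂] [ChartedSpace H₂ M₂] [IsManifold I₂ ∞ M₂]

/-- The scalar product `((u₁, u₂), (v₁, v₂)) ↦ g₁(u₁, v₁) + g₂(u₂, v₂)` on
`T_p (M₁ × M₂) = T_{p.1} M₁ × T_{p.2} M₂`. -/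
noncomputable def prodForm (g₁ : Metric I₁ M₁) (g₂ : Metric I₂ M₂) (p : M₁ × M₂) :
    E₁ × E₂ →L[ℝ] E₁ × E₂ →L[ℝ] ℝ :=
  (formAt g₁ p.1).bilinearComp (fst ℝ E₁ E₂) (fst ℝ E₁ E₂)
    + (formAt g₂ p.2).bilinearComp (snd ℝ E₁ E₂) (snd ℝ E₁ E₂)

theorem prodForm_apply (g₁ : Metric I₁ M₁) (g₂ : Metric I₂ M₂) (p : M₁ × M₂) (u v : E₁ × E₂) :
    prodForm g₁ g₂ p u v = g₁.inner p.1 u.1 v.1 + g₂.inner p.2 u.2 v.2 := rfl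

theorem form_nonneg (g : Metric I₁ M₁) (p : M₁) (v : E₁) : 0 ≤ formAt g p v v := by
  by_cases h : v = 0
  · simp [h]
  · exact (g.pos p v h).le

variable [I₁.Boundaryless] [I₂.Boundaryless]

theorem symmL_prod (x p : M₁ × M₂) (h₁ : p.1 ∈ (chartAt H₁ x.1).source)
    (h₂ : p.2 ∈ (chartAt H₂ x.2).source) (v : E₁ × E₂) :
    ((trivializationAt (E₁ × E₂) (TangentSpace (I₁.prod I₂)) x).symmL ℝ p v : E₁ × E₂)
      = ((trivializationAt E₁ (TangentSpace I₁) x.1).symmL ℝ p.1 v.1,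
          (trivializationAt E₂ (TangentSpace I₂) x.2).symmL ℝ p.2 v.2) := by
  have h : p ∈ (chartAt (ModelProd H₁ H₂) x).source := by
    simp [h₁, h₂]
  rw [TangentBundle.symmL_trivializationAt h, TangentBundle.symmL_trivializationAt h₁,
    TangentBundle.symmL_trivializationAt h₂]
  simp only [ModelWithCorners.range_eq_univ, mfderivWithin_univ]
  have d₁ : MDifferentiableAt 𝓘(ℝ, E₁) I₁ (extChartAt I₁ x.1).symm (extChartAt I₁ x.1 p.1) :=
    ((contMDiffOn_extChartAt_symm (I := I₁) (n := ∞) x.1).contMDiffAt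
      ((isOpen_extChartAt_target x.1).mem_nhds
        ((extChartAt I₁ x.1).map_source (by simpa using h₁)))).mdifferentiableAt (by simp)
  have d₂ : MDifferentiableAt 𝓘(ℝ, E₂) I₂ (extChartAt I₂ x.2).symm (extChartAt I₂ x.2 p.2) :=
    ((contMDiffOn_extChartAt_symm (I := I₂) (n := ∞) x.2).contMDiffAt
      ((isOpen_extChartAt_target x.2).mem_nhds
        ((extChartAt I₂ x.2).map_source (by simpa using h₂)))).mdifferentiableAt (by simp)
  have d := (HasMFDerivAt.prodMap (p := (extChartAt I₁ x.1 p.1, extChartAt I₂ x.2 p.2))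
    d₁.hasMFDerivAt d₂.hasMFDerivAt)
  rw [← modelWithCornersSelf_prod, chartedSpaceSelf_prod] at d
  have e := @HasMFDerivAt.mfderiv _ _ _ _ _ _ _ _ _ _ (chartedSpaceSelf (E₁ × E₂))
    _ _ _ _ _ _ _ _ _ _ _ _ d
  exact congrArg (fun L : E₁ × E₂ →L[ℝ] E₁ × E₂ => L v) e

theorem contMDiff_prodForm (g₁ : Metric I₁ M₁) (g₂ : Metric I₂ M₂) :
    ContMDiff (I₁.prod I₂) ((I₁.prod I₂).prod 𝓘(ℝ, E₁ × E₂ →L[ℝ] E₁ × E₂ →L[ℝ] ℝ)) ∞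
      (fun b : M₁ × M₂ => Bundle.TotalSpace.mk' (E₁ × E₂ →L[ℝ] E₁ × E₂ →L[ℝ] ℝ)
        (E := fun b : M₁ × M₂ =>
          TangentSpace (I₁.prod I₂) b →L[ℝ] TangentSpace (I₁.prod I₂) b →L[ℝ] ℝ)
        b (prodForm g₁ g₂ b)) := by
  intro x
  rw [contMDiffAt_hom_bundle]
  refine ⟨contMDiffAt_id, ?_⟩
  have k₁ := (((contMDiffAt_hom_bundle _).1 (g₁.contMDiff x.1)).2).comp x
    (contMDiffAt_fst (I := I₁) (J := I₂) (n := ∞))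
  have k₂ := (((contMDiffAt_hom_bundle _).1 (g₂.contMDiff x.2)).2).comp x
    (contMDiffAt_snd (I := I₁) (J := I₂) (n := ∞))
  have m₁ := ((contMDiffAt_const (c := (compL ℝ (E₁ × E₂) E₁ ℝ).flip (fst ℝ E₁ E₂))).clm_comp
    k₁).clm_comp (contMDiffAt_const (c := fst ℝ E₁ E₂))
  have m₂ := ((contMDiffAt_const (c := (compL ℝ (E₁ × E₂) E₂ ℝ).flip (snd ℝ E₁ E₂))).clm_comp
    k₂).clm_comp (contMDiffAt_const (c := snd ℝ E₁ E₂))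
  refine (m₁.add m₂).congr_of_eventuallyEq ?_
  have o₁ : ∀ᶠ p : M₁ × M₂ in 𝓝 x, p.1 ∈ (chartAt H₁ x.1).source :=
    continuousAt_fst.eventually ((chartAt H₁ x.1).open_source.mem_nhds (mem_chart_source H₁ x.1))
  have o₂ : ∀ᶠ p : M₁ × M₂ in 𝓝 x, p.2 ∈ (chartAt H₂ x.2).source :=
    continuousAt_snd.eventually ((chartAt H₂ x.2).open_source.mem_nhds (mem_chart_source H₂ x.2))
  filter_upwards [o₁, o₂] with p h₁ h₂
  have h : p ∈ (chartAt (ModelProd H₁ H₂) x).source := by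
    simp [h₁, h₂]
  refine ContinuousLinearMap.ext fun v => ContinuousLinearMap.ext fun w => ?_
  refine (inCoordinates_bilin (I := I₁.prod I₂) x p h _ v w).trans ?_
  refine (prodForm_apply g₁ g₂ p _ _).trans ?_
  rw [symmL_prod x p h₁ h₂, symmL_prod x p h₁ h₂]
  exact congrArg₂ (· + ·) (inCoordinates_bilin x.1 p.1 h₁ (g₁.inner p.1) v.1 w.1).symm
    (inCoordinates_bilin x.2 p.2 h₂ (g₂.inner p.2) v.2 w.2).symm

/-- The product metric `g₁ ⊕ g₂`. -/
noncomputable def prodMetric (g₁ : Metric I₁ M₁) (g₂ : Metric I₂ M₂) :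
    Metric (I₁.prod I₂) (M₁ × M₂) where
  inner p := prodForm g₁ g₂ p
  symm p u v := by
    exact congrArg₂ (· + ·) (g₁.symm p.1 u.1 v.1) (g₂.symm p.2 u.2 v.2)
  pos p v hv := by
    have h1 := form_nonneg g₁ p.1 v.1
    have h2 := form_nonneg g₂ p.2 v.2
    by_cases h : v.1 = 0
    · have h' : v.2 ≠ 0 := fun h' => hv (Prod.ext h h')
      exact add_pos_of_nonneg_of_pos h1 (g₂.pos p.2 v.2 h')
    · exact add_pos_of_pos_of_nonneg (g₁.pos p.1 v.1 h) h2
  isVonNBounded p := by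
    have b₁ : Bornology.IsBounded {v : E₁ | formAt g₁ p.1 v v < 1} :=
      (NormedSpace.isVonNBounded_iff ℝ).1 (g₁.isVonNBounded p.1)
    have b₂ : Bornology.IsBounded {v : E₂ | formAt g₂ p.2 v v < 1} :=
      (NormedSpace.isVonNBounded_iff ℝ).1 (g₂.isVonNBounded p.2)
    have b : Bornology.IsBounded {v : E₁ × E₂ | prodForm g₁ g₂ p v v < 1} := by
      refine (b₁.prod b₂).subset fun v hv => ?_
      have hv' : formAt g₁ p.1 v.1 v.1 + formAt g₂ p.2 v.2 v.2 < 1 := hv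
      have n₁ := form_nonneg g₁ p.1 v.1
      have n₂ := form_nonneg g₂ p.2 v.2
      exact ⟨show formAt g₁ p.1 v.1 v.1 < 1 by linarith,
        show formAt g₂ p.2 v.2 v.2 < 1 by linarith⟩
    exact (NormedSpace.isVonNBounded_iff ℝ).2 b
  contMDiff := contMDiff_prodForm g₁ g₂

end Product

end RicciHessian

/-!
In a product chart the metric `g₁ ⊕ g₂` is a block sum, hence so are its Christoffel symbols and
its curvature, and the Ricci tensor of the product is `Ric₁ ⊕ Ric₂` (`ricci_prodMetric`). Since this
has no mixed part, neither has the Hessian of a solution `f`: the mixed second derivatives of `f` in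
product charts vanish. On connected factors this forces `f(x₁, x₂) = a(x₁) + b(x₂)`
(`sub_eq_sub_of_hessian_mixed_eq_zero`), and the equation splits into
`∇²a = -(a + b) Ric₁` and `∇²b = -(a + b) Ric₂` (`isSolution_prodMetric_iff`).

At a point `q` with `Ric₂(q) ≠ 0` the second equation determines `a(x₁) + b(q)` independently of
`x₁`, so `a` is constant and `f` depends on `x₂` only (`eq_of_isSolution_prodMetric`). For a
function `h(x₂)` the equations read `h(x₂) Ric₁(x₁) = 0` and `∇²h = -h Ric₂`
(`isSolution_prodMetric_snd_iff`); a nonzero solution therefore exists only if `Ric₁ = 0`, and the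
statement about the solution spaces follows.

The Hessian at a point is defined in the chart around that very point, and different points of the
manifold use different charts. Constancy arguments are therefore phrased for functions that are
defined without reference to a chart in the variable that moves: `x₂ ↦ d₁f(x₁, x₂)` for fixed
`x₁`, then `x₁ ↦ f(x₁, x₂) - f(x₁, x₂')`. For these it suffices that the derivative vanishes at the
centre of each chart (`eq_of_hasFDerivAt_zero`), and no transformation law for the Hessian is
needed.
-/

namespace RicciHessian

open ContinuousLinearMap
open scoped Topology

set_option maxSynthPendingDepth 3

/-! ### Product metrics in a product of vector spaces -/

section LocalProduct

theorem eventually_prod {X Y : Type*} [TopologicalSpace X] [TopologicalSpace Y] {z : X × Y}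
    {p : X → Prop} {q : Y → Prop} (h₁ : ∀ᶠ y in 𝓝 z.1, p y) (h₂ : ∀ᶠ y in 𝓝 z.2, q y) :
    ∀ᶠ z' in 𝓝 z, p z'.1 ∧ q z'.2 :=
  (continuousAt_fst.eventually h₁).and (continuousAt_snd.eventually h₂)

variable {E F E₁ F₁ E₂ : Type*}
  [NormedAddCommGroup E] [NormedSpace ℝ E] [NormedAddCommGroup F] [NormedSpace ℝ F]
  [NormedAddCommGroup E₁] [NormedSpace ℝ E₁] [NormedAddCommGroup F₁] [NormedSpace ℝ F₁]
  [NormedAddCommGroup E₂] [NormedSpace ℝ E₂]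

/-- The bilinear map `(u, v) ↦ ι (B (π u, π v))`, as a continuous linear function of `B`. -/
noncomputable def pull (π : E →L[ℝ] E₁) (ι : F₁ →L[ℝ] F) :
    (E₁ →L[ℝ] E₁ →L[ℝ] F₁) →L[ℝ] E →L[ℝ] E →L[ℝ] F :=
  (compL ℝ E (E₁ →L[ℝ] F₁) (E →L[ℝ] F)
      ((compL ℝ E E₁ F).flip π ∘L compL ℝ E₁ F₁ F ι))
    ∘L (compL ℝ E E₁ (E₁ →L[ℝ] F₁)).flip π

@[simp]
theorem pull_apply (π : E →L[ℝ] E₁) (ι : F₁ →L[ℝ] F) (B : E₁ →L[ℝ] E₁ →L[ℝ] F₁) (u v : E) :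
    pull π ι B u v = ι (B (π u) (π v)) := by
  simp [pull]

/-- The field of bilinear forms `G₁ ⊕ G₂` on `E₁ × E₂`. -/
noncomputable def sumForm (G₁ : E₁ → E₁ →L[ℝ] E₁ →L[ℝ] ℝ) (G₂ : E₂ → E₂ →L[ℝ] E₂ →L[ℝ] ℝ)
    (z : E₁ × E₂) : E₁ × E₂ →L[ℝ] E₁ × E₂ →L[ℝ] ℝ :=
  pull (fst ℝ E₁ E₂) (.id ℝ ℝ) (G₁ z.1) + pull (snd ℝ E₁ E₂) (.id ℝ ℝ) (G₂ z.2)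

variable {G : E₁ × E₂ → E₁ × E₂ →L[ℝ] E₁ × E₂ →L[ℝ] ℝ}
  {G₁ : E₁ → E₁ →L[ℝ] E₁ →L[ℝ] ℝ} {G₂ : E₂ → E₂ →L[ℝ] E₂ →L[ℝ] ℝ} {z : E₁ × E₂}

/-- Raising an index with `G₁ ⊕ G₂` raises the two components separately. -/
theorem inverse_sumForm (h₁ : (G₁ z.1).IsInvertible) (h₂ : (G₂ z.2).IsInvertible)
    (φ : E₁ × E₂ →L[ℝ] ℝ) :
    (sumForm G₁ G₂ z).inverse φ
      = ((G₁ z.1).inverse (φ ∘L inl ℝ E₁ E₂), (G₂ z.2).inverse (φ ∘L inr ℝ E₁ E₂)) := by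
  have key : (sumForm G₁ G₂ z).inverse
      = ((G₁ z.1).inverse ∘L (compL ℝ E₁ (E₁ × E₂) ℝ).flip (inl ℝ E₁ E₂)).prod
        ((G₂ z.2).inverse ∘L (compL ℝ E₂ (E₁ × E₂) ℝ).flip (inr ℝ E₁ E₂)) := by
    obtain ⟨e₁, he₁⟩ := h₁
    obtain ⟨e₂, he₂⟩ := h₂
    rw [← he₁, ← he₂]
    apply inverse_eq
    · ext φ u
      · simp [sumForm, ← he₁]
      · simp [sumForm, ← he₂]
    · ext u
      · suffices h : e₁.symm ((sumForm G₁ G₂ z (u, 0)) ∘L inl ℝ E₁ E₂) = u by simpa using h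
        rw [ContinuousLinearEquiv.symm_apply_eq]
        ext v; simp [sumForm, ← he₁]
      · suffices h : e₂.symm ((sumForm G₁ G₂ z (u, 0)) ∘L inr ℝ E₁ E₂) = 0 by simpa using h
        rw [ContinuousLinearEquiv.symm_apply_eq]
        ext v; simp [sumForm]
      · suffices h : e₁.symm ((sumForm G₁ G₂ z (0, u)) ∘L inl ℝ E₁ E₂) = 0 by simpa using h
        rw [ContinuousLinearEquiv.symm_apply_eq]
        ext v; simp [sumForm]
      · suffices h : e₂.symm ((sumForm G₁ G₂ z (0, u)) ∘L inr ℝ E₁ E₂) = u by simpa using h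
        rw [ContinuousLinearEquiv.symm_apply_eq]
        ext v; simp [sumForm, ← he₂]
  rw [key]
  rfl

theorem hasFDerivAt_pull_add_pull {F₂ : Type*} [NormedAddCommGroup F₂] [NormedSpace ℝ F₂]
    {B₁ : E₁ → E₁ →L[ℝ] E₁ →L[ℝ] F₁} {B₂ : E₂ → E₂ →L[ℝ] E₂ →L[ℝ] F₂}
    (ι₁ : F₁ →L[ℝ] F) (ι₂ : F₂ →L[ℝ] F)
    (h₁ : DifferentiableAt ℝ B₁ z.1) (h₂ : DifferentiableAt ℝ B₂ z.2) :
    HasFDerivAt (fun z : E₁ × E₂ =>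
        pull (fst ℝ E₁ E₂) ι₁ (B₁ z.1) + pull (snd ℝ E₁ E₂) ι₂ (B₂ z.2))
      ((pull (fst ℝ E₁ E₂) ι₁ ∘L fderiv ℝ B₁ z.1) ∘L fst ℝ E₁ E₂
        + (pull (snd ℝ E₁ E₂) ι₂ ∘L fderiv ℝ B₂ z.2) ∘L snd ℝ E₁ E₂) z :=
  (((pull (fst ℝ E₁ E₂) ι₁).hasFDerivAt.comp z.1 h₁.hasFDerivAt).comp z hasFDerivAt_fst).add
    (((pull (snd ℝ E₁ E₂) ι₂).hasFDerivAt.comp z.2 h₂.hasFDerivAt).comp z hasFDerivAt_snd)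

theorem koszul_sumForm (h₁ : DifferentiableAt ℝ G₁ z.1) (h₂ : DifferentiableAt ℝ G₂ z.2)
    (u v w : E₁ × E₂) :
    koszul (sumForm G₁ G₂) z u v w
      = koszul G₁ z.1 u.1 v.1 w.1 + koszul G₂ z.2 u.2 v.2 w.2 := by
  have e : fderiv ℝ (sumForm G₁ G₂) z = _ := (hasFDerivAt_pull_add_pull _ _ h₁ h₂).fderiv
  simp only [koszul_apply, e]
  simp
  ring

/-- The Christoffel symbols of a product metric are the direct sum of those of the factors. -/
theorem christoffel_sumForm (h₁ : DifferentiableAt ℝ G₁ z.1) (h₂ : DifferentiableAt ℝ G₂ z.2)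
    (i₁ : (G₁ z.1).IsInvertible) (i₂ : (G₂ z.2).IsInvertible) :
    christoffel (sumForm G₁ G₂) z
      = pull (fst ℝ E₁ E₂) (inl ℝ E₁ E₂) (christoffel G₁ z.1)
        + pull (snd ℝ E₁ E₂) (inr ℝ E₁ E₂) (christoffel G₂ z.2) := by
  refine ContinuousLinearMap.ext fun u => ContinuousLinearMap.ext fun v => ?_
  have k₁ : koszul (sumForm G₁ G₂) z u v ∘L inl ℝ E₁ E₂ = koszul G₁ z.1 u.1 v.1 := by
    ext w; simp [koszul_sumForm h₁ h₂]
  have k₂ : koszul (sumForm G₁ G₂) z u v ∘L inr ℝ E₁ E₂ = koszul G₂ z.2 u.2 v.2 := by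
    ext w; simp [koszul_sumForm h₁ h₂]
  rw [christoffel_apply, inverse_sumForm i₁ i₂, k₁, k₂]
  simp [christoffel_apply]

/-- A field of bilinear forms that, near `y`, is twice continuously differentiable and
nondegenerate. -/
structure IsRegularAt (G : E → E →L[ℝ] E →L[ℝ] ℝ) (y : E) : Prop where
  contDiffAt : ContDiffAt ℝ 2 G y
  eventually_isInvertible : ∀ᶠ y' in 𝓝 y, (G y').IsInvertible

namespace IsRegularAt

variable {G : E → E →L[ℝ] E →L[ℝ] ℝ} {y : E}

theorem isInvertible (h : IsRegularAt G y) : (G y).IsInvertible :=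
  h.eventually_isInvertible.self_of_nhds

theorem eventually_differentiableAt (h : IsRegularAt G y) :
    ∀ᶠ y' in 𝓝 y, DifferentiableAt ℝ G y' :=
  (h.contDiffAt.eventually (by simp)).mono fun _ h' => h'.differentiableAt (by simp)

theorem differentiableAt (h : IsRegularAt G y) : DifferentiableAt ℝ G y :=
  h.eventually_differentiableAt.self_of_nhds

theorem differentiableAt_inverse [CompleteSpace E] (h : IsRegularAt G y) :
    DifferentiableAt ℝ (fun y' => (G y').inverse) y :=
  ((h.isInvertible.contDiffAt_map_inverse (n := 2)).comp y h.contDiffAt).differentiableAt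
    (by simp)

theorem differentiableAt_christoffel [CompleteSpace E] (h : IsRegularAt G y) :
    DifferentiableAt ℝ (christoffel G) y := by
  have hD : DifferentiableAt ℝ (fderiv ℝ G) y :=
    (h.contDiffAt.fderiv_right (m := 1) (by norm_num)).differentiableAt (by simp)
  have hf : DifferentiableAt ℝ (fun y' => (fderiv ℝ G y').flip) y :=
    (flipₗᵢ ℝ E E (E →L[ℝ] ℝ)).toContinuousLinearEquiv.differentiableAt.comp y hD
  have hk : DifferentiableAt ℝ (koszul G) y :=
    ((hD.add hf).sub ((differentiableAt_const ((flipₗᵢ ℝ E E ℝ).toContinuousLinearEquiv :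
      (E →L[ℝ] E →L[ℝ] ℝ) →L[ℝ] E →L[ℝ] E →L[ℝ] ℝ)).clm_comp hf)).const_smul (2⁻¹ : ℝ)
  exact ((compL ℝ E (E →L[ℝ] ℝ) E).differentiableAt.comp y h.differentiableAt_inverse).clm_comp hk

end IsRegularAt

theorem christoffel_eventuallyEq (h : G =ᶠ[𝓝 z] sumForm G₁ G₂) :
    christoffel G =ᶠ[𝓝 z] christoffel (sumForm G₁ G₂) := by
  filter_upwards [h.eventuallyEq_nhds] with y hy
  simp only [christoffel, koszul, hy.fderiv_eq, hy.eq_of_nhds]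

theorem christoffel_eventuallyEq_pull (h₁ : IsRegularAt G₁ z.1) (h₂ : IsRegularAt G₂ z.2)
    (hG : G =ᶠ[𝓝 z] sumForm G₁ G₂) :
    christoffel G =ᶠ[𝓝 z] fun y => pull (fst ℝ E₁ E₂) (inl ℝ E₁ E₂) (christoffel G₁ y.1)
        + pull (snd ℝ E₁ E₂) (inr ℝ E₁ E₂) (christoffel G₂ y.2) := by
  filter_upwards [christoffel_eventuallyEq hG,
    eventually_prod h₁.eventually_differentiableAt h₂.eventually_differentiableAt,
    eventually_prod h₁.eventually_isInvertible h₂.eventually_isInvertible] with y e d i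
  rw [e, christoffel_sumForm d.1 d.2 i.1 i.2]

theorem gradient_eventuallyEq (h₁ : IsRegularAt G₁ z.1) (h₂ : IsRegularAt G₂ z.2)
    (hG : G =ᶠ[𝓝 z] sumForm G₁ G₂) (F : E₁ × E₂ → ℝ) :
    gradient G F =ᶠ[𝓝 z] fun y => ((G₁ y.1).inverse (fderiv ℝ F y ∘L inl ℝ E₁ E₂),
      (G₂ y.2).inverse (fderiv ℝ F y ∘L inr ℝ E₁ E₂)) := by
  filter_upwards [hG, eventually_prod h₁.eventually_isInvertible h₂.eventually_isInvertible]
    with y e i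
  rw [gradient, e, inverse_sumForm i.1 i.2]

/-- The curvature operators of a product metric preserve the two factors. -/
theorem curvature_eq_prodMap [CompleteSpace E₁] [CompleteSpace E₂]
    (h₁ : IsRegularAt G₁ z.1) (h₂ : IsRegularAt G₂ z.2)
    (hG : G =ᶠ[𝓝 z] sumForm G₁ G₂) (v w : E₁ × E₂) :
    curvature G z v w = (curvature G₁ z.1 v.1 w.1).prodMap (curvature G₂ z.2 v.2 w.2) := by
  have hΓ := christoffel_eventuallyEq_pull h₁ h₂ hG
  have hD := hΓ.fderiv_eq.trans (hasFDerivAt_pull_add_pull (inl ℝ E₁ E₂) (inr ℝ E₁ E₂)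
    h₁.differentiableAt_christoffel h₂.differentiableAt_christoffel).fderiv
  refine ContinuousLinearMap.ext fun u => ?_
  rw [curvature_apply, hΓ.eq_of_nhds, hD]
  ext <;> simp [curvature_apply]

/-- The Hessian of `a(y₁) + b(y₂)` with respect to a product metric is block diagonal. -/
theorem covDeriv_gradient_eq_prodMap (h₁ : IsRegularAt G₁ z.1) (h₂ : IsRegularAt G₂ z.2)
    (hG : G =ᶠ[𝓝 z] sumForm G₁ G₂) {F : E₁ × E₂ → ℝ} {a : E₁ → ℝ} {b : E₂ → ℝ}
    (ha : ∀ᶠ y in 𝓝 z.1, DifferentiableAt ℝ a y) (hb : ∀ᶠ y in 𝓝 z.2, DifferentiableAt ℝ b y)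
    (hF : F =ᶠ[𝓝 z] fun y => a y.1 + b y.2)
    (da : DifferentiableAt ℝ (gradient G₁ a) z.1) (db : DifferentiableAt ℝ (gradient G₂ b) z.2) :
    covDeriv G (gradient G F) z
      = (covDeriv G₁ (gradient G₁ a) z.1).prodMap (covDeriv G₂ (gradient G₂ b) z.2) := by
  have hX : gradient G F =ᶠ[𝓝 z] fun y => (gradient G₁ a y.1, gradient G₂ b y.2) := by
    filter_upwards [gradient_eventuallyEq h₁ h₂ hG F, eventually_prod ha hb,
      hF.eventuallyEq_nhds] with y hy d hFy
    have e : fderiv ℝ F y = fderiv ℝ a y.1 ∘L fst ℝ E₁ E₂ + fderiv ℝ b y.2 ∘L snd ℝ E₁ E₂ :=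
      hFy.fderiv_eq.trans ((d.1.hasFDerivAt.comp y hasFDerivAt_fst).add
        (d.2.hasFDerivAt.comp y hasFDerivAt_snd)).fderiv
    have e₁ : fderiv ℝ F y ∘L inl ℝ E₁ E₂ = fderiv ℝ a y.1 := by rw [e]; ext; simp
    have e₂ : fderiv ℝ F y ∘L inr ℝ E₁ E₂ = fderiv ℝ b y.2 := by rw [e]; ext; simp
    rw [hy, e₁, e₂]
    rfl
  have hD := hX.fderiv_eq.trans (da.hasFDerivAt.prodMap z db.hasFDerivAt).fderiv
  rw [covDeriv, hD, hX.eq_of_nhds, (christoffel_eventuallyEq_pull h₁ h₂ hG).eq_of_nhds]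
  refine ContinuousLinearMap.ext fun u => ?_
  ext <;> simp [covDeriv]

/-- If the mixed part of the Hessian of `F` with respect to a product metric vanishes at `z`, then
so do the derivatives in the direction of `E₂` of the partial derivatives of `F` along `E₁`. -/
theorem hasFDerivAt_zero_of_covDeriv_gradient (h₁ : IsRegularAt G₁ z.1)
    (h₂ : IsRegularAt G₂ z.2) (hG : G =ᶠ[𝓝 z] sumForm G₁ G₂) {F : E₁ × E₂ → ℝ}
    (hd : DifferentiableAt ℝ (gradient G F) z)
    (hmix : ∀ u : E₂, (covDeriv G (gradient G F) z (0, u)).1 = 0) :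
    HasFDerivAt (𝕜 := ℝ) (fun y => fderiv ℝ F (z.1, y) ∘L inl ℝ E₁ E₂) 0 z.2 := by
  have hX := gradient_eventuallyEq h₁ h₂ hG F
  have hι : HasFDerivAt (fun y : E₂ => (z.1, y)) (inr ℝ E₁ E₂) z.2 := hasFDerivAt_prodMk_right _ _
  -- At fixed first coordinate, lowering the index of the first component of the gradient with the
  -- constant form `G₁ z.1` gives back the partial differential along `E₁`.
  let L : E₁ × E₂ →L[ℝ] E₁ →L[ℝ] ℝ := G₁ z.1 ∘L fst ℝ E₁ E₂
  have hc : HasFDerivAt (fun y : E₂ => L (gradient G F (z.1, y)))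
      ((L ∘L fderiv ℝ (gradient G F) z) ∘L inr ℝ E₁ E₂) z.2 :=
    HasFDerivAt.comp (g := L ∘ gradient G F) z.2 (L.hasFDerivAt.comp z hd.hasFDerivAt) hι
  have h0 : (L ∘L fderiv ℝ (gradient G F) z) ∘L inr ℝ E₁ E₂ = 0 := by
    ext1 u
    have := hmix u
    rw [covDeriv, (christoffel_eventuallyEq_pull h₁ h₂ hG).eq_of_nhds] at this
    simp at this
    simp [L, this]
  rw [h0] at hc
  refine hc.congr_of_eventuallyEq ?_
  filter_upwards [hι.continuousAt.eventually hX] with y hy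
  rw [hy]
  obtain ⟨e, he⟩ := h₁.isInvertible
  simp [L, ← he]

variable [FiniteDimensional ℝ E₁] [FiniteDimensional ℝ E₂]

theorem ricciForm_apply [FiniteDimensional ℝ E] (G : E → E →L[ℝ] E →L[ℝ] ℝ) (y v w : E) :
    ricciForm G y v w = LinearMap.trace ℝ E (curvature G y v w : E →ₗ[ℝ] E) := rfl

theorem ricciEndo_apply [FiniteDimensional ℝ E] (G : E → E →L[ℝ] E →L[ℝ] ℝ) (y v : E) :
    ricciEndo G y v
      = (G y).inverse (LinearMap.toContinuousLinearMap (ricciForm G y v)) := rfl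

theorem ricciEndo_eq_prodMap (h₁ : IsRegularAt G₁ z.1) (h₂ : IsRegularAt G₂ z.2)
    (hG : G =ᶠ[𝓝 z] sumForm G₁ G₂) :
    ricciEndo G z = (ricciEndo G₁ z.1).prodMap (ricciEndo G₂ z.2) := by
  have hr : ∀ v w, ricciForm G z v w = ricciForm G₁ z.1 v.1 w.1 + ricciForm G₂ z.2 v.2 w.2 := by
    intro v w
    have := FiniteDimensional.complete ℝ E₁
    have := FiniteDimensional.complete ℝ E₂
    rw [ricciForm_apply, curvature_eq_prodMap h₁ h₂ hG]
    exact LinearMap.trace_prodMap' _ _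
  refine ContinuousLinearMap.ext fun v => ?_
  rw [ricciEndo_apply, hG.eq_of_nhds, inverse_sumForm h₁.isInvertible h₂.isInvertible,
    coe_prodMap', Prod.map_apply', ricciEndo_apply, ricciEndo_apply]
  congr 2
  · ext w; simp [hr]
  · ext w; simp [hr]

end LocalProduct

/-! ### Functions with vanishing derivative on a connected manifold -/

section LocallyConstant

variable {E : Type*} [NormedAddCommGroup E] [NormedSpace ℝ E]
  {H : Type*} [TopologicalSpace H] {I : ModelWithCorners ℝ E H}
  {M : Type*} [TopologicalSpace M] [ChartedSpace H M]
  {V : Type*} [NormedAddCommGroup V] [NormedSpace ℝ V]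

theorem hasMFDerivAt_of_comp_extChartAt_symm {φ : M → V} {x : M} {φ' : E →L[ℝ] V}
    (h : HasFDerivAt (φ ∘ (extChartAt I x).symm) φ' (extChartAt I x x)) :
    HasMFDerivAt I 𝓘(ℝ, V) φ x φ' := by
  refine ⟨?_, ?_⟩
  · refine (h.continuousAt.comp (continuousAt_extChartAt (I := I) x)).congr ?_
    filter_upwards [extChartAt_source_mem_nhds (I := I) x] with y hy
    simp only [Function.comp_apply, (extChartAt I x).left_inv hy]
  · exact h.hasFDerivWithinAt

variable [I.Boundaryless] [IsManifold I ∞ M]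

/-- It suffices to test the derivative at each point in the chart around that point. -/
theorem eq_of_hasFDerivAt_zero [PreconnectedSpace M] {φ : M → V}
    (h : ∀ x : M, HasFDerivAt (φ ∘ (extChartAt I x).symm) (0 : E →L[ℝ] V) (extChartAt I x x))
    (x y : M) : φ x = φ y := by
  have hφ : ∀ x, HasMFDerivAt I 𝓘(ℝ, V) φ x (0 : E →L[ℝ] V) :=
    fun x => hasMFDerivAt_of_comp_extChartAt_symm (h x)
  have hloc : IsLocallyConstant φ := by
    rw [IsLocallyConstant.iff_eventually_eq]
    intro x
    have hT := isOpen_extChartAt_target (I := I) x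
    have hd : ∀ y ∈ (extChartAt I x).target,
        HasFDerivAt (φ ∘ (extChartAt I x).symm) (0 : E →L[ℝ] V) y := by
      intro y hy
      have d : MDifferentiableAt 𝓘(ℝ, E) I (extChartAt I x).symm y :=
        ((contMDiffOn_extChartAt_symm (I := I) (n := ∞) x).contMDiffAt
          (hT.mem_nhds hy)).mdifferentiableAt (by simp)
      have c := ((hφ _).comp y d.hasMFDerivAt).hasFDerivAt
      have e : ((0 : E →L[ℝ] V).comp (mfderiv 𝓘(ℝ, E) I (extChartAt I x).symm y : E →L[ℝ] E)
        : E →L[ℝ] V) = 0 := zero_comp _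
      exact e ▸ c
    have ho : ∀ᶠ y in 𝓝 (extChartAt I x x),
        (φ ∘ (extChartAt I x).symm) y = φ x := by
      have := hT.isOpen_inter_preimage_of_fderiv_eq_zero (𝕜 := ℝ)
        (fun y hy => (hd y hy).differentiableAt.differentiableWithinAt)
        (fun y hy => (hd y hy).fderiv) {φ x}
      refine Filter.mem_of_superset (this.mem_nhds ⟨mem_extChartAt_target x, ?_⟩)
        fun y hy => hy.2
      simp
    filter_upwards [(continuousAt_extChartAt (I := I) x).eventually ho,
      extChartAt_source_mem_nhds (I := I) x] with y hy hys
    simpa only [Function.comp_apply, (extChartAt I x).left_inv hys] using hy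
  exact hloc.apply_eq_of_preconnectedSpace x y

end LocallyConstant

/-! ### The Ricci tensor and the Hessian of a Riemannian product -/

section Product

theorem hessian_zero {E H : Type*} [NormedAddCommGroup E] [NormedSpace ℝ E]
    [TopologicalSpace H] {I : ModelWithCorners ℝ E H} {M : Type*} [TopologicalSpace M]
    [ChartedSpace H M] [IsManifold I ∞ M] (g : Metric I M) (x : M) :
    hessian g (0 : M → ℝ) x = 0 := by
  have h := hessian_smul g 0 (0 : M → ℝ) x
  rwa [zero_smul, zero_smul] at h

variable
  {E₁ : Type*} [NormedAddCommGroup E₁] [NormedSpace ℝ E₁]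
  {H₁ : Type*} [TopologicalSpace H₁] {I₁ : ModelWithCorners ℝ E₁ H₁}
  {M₁ : Type*} [TopologicalSpace M₁] [ChartedSpace H₁ M₁]
  {E₂ : Type*} [NormedAddCommGroup E₂] [NormedSpace ℝ E₂]
  {H₂ : Type*} [TopologicalSpace H₂] {I₂ : ModelWithCorners ℝ E₂ H₂}
  {M₂ : Type*} [TopologicalSpace M₂] [ChartedSpace H₂ M₂]

theorem comp_extChartAt_symm_prod (f : M₁ × M₂ → ℝ) (x : M₁ × M₂) (y : E₁ × E₂) :
    (f ∘ (extChartAt (I₁.prod I₂) x).symm) y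
      = f ((extChartAt I₁ x.1).symm y.1, (extChartAt I₂ x.2).symm y.2) := by
  rw [extChartAt_prod]
  rfl

variable [I₁.Boundaryless] [IsManifold I₁ ∞ M₁] [I₂.Boundaryless] [IsManifold I₂ ∞ M₂]

theorem mfderiv_extChartAt_symm_prod (x : M₁ × M₂) {y : E₁ × E₂}
    (h₁ : y.1 ∈ (extChartAt I₁ x.1).target) (h₂ : y.2 ∈ (extChartAt I₂ x.2).target) :
    (mfderiv 𝓘(ℝ, E₁ × E₂) (I₁.prod I₂) (extChartAt (I₁.prod I₂) x).symm y :
        E₁ × E₂ →L[ℝ] E₁ × E₂)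
      = (mfderiv 𝓘(ℝ, E₁) I₁ (extChartAt I₁ x.1).symm y.1 : E₁ →L[ℝ] E₁).prodMap
        (mfderiv 𝓘(ℝ, E₂) I₂ (extChartAt I₂ x.2).symm y.2 : E₂ →L[ℝ] E₂) := by
  have d₁ : MDifferentiableAt 𝓘(ℝ, E₁) I₁ (extChartAt I₁ x.1).symm y.1 :=
    ((contMDiffOn_extChartAt_symm (I := I₁) (n := ∞) x.1).contMDiffAt
      ((isOpen_extChartAt_target x.1).mem_nhds h₁)).mdifferentiableAt (by simp)
  have d₂ : MDifferentiableAt 𝓘(ℝ, E₂) I₂ (extChartAt I₂ x.2).symm y.2 :=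
    ((contMDiffOn_extChartAt_symm (I := I₂) (n := ∞) x.2).contMDiffAt
      ((isOpen_extChartAt_target x.2).mem_nhds h₂)).mdifferentiableAt (by simp)
  have d := (HasMFDerivAt.prodMap (p := (y.1, y.2)) d₁.hasMFDerivAt d₂.hasMFDerivAt)
  rw [← modelWithCornersSelf_prod, chartedSpaceSelf_prod] at d
  rw [extChartAt_prod]
  exact @HasMFDerivAt.mfderiv _ _ _ _ _ _ _ _ _ _ (chartedSpaceSelf (E₁ × E₂))
    _ _ _ _ _ _ _ _ _ _ _ _ d

theorem chartMetric_prodMetric (g₁ : Metric I₁ M₁) (g₂ : Metric I₂ M₂) (x : M₁ × M₂) :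
    chartMetric (prodMetric g₁ g₂) x
      =ᶠ[𝓝 (extChartAt I₁ x.1 x.1, extChartAt I₂ x.2 x.2)]
        sumForm (chartMetric g₁ x.1) (chartMetric g₂ x.2) := by
  filter_upwards [eventually_prod (z := (extChartAt I₁ x.1 x.1, extChartAt I₂ x.2 x.2))
    (extChartAt_target_mem_nhds x.1) (extChartAt_target_mem_nhds x.2)] with y hy
  refine ContinuousLinearMap.ext fun u => ContinuousLinearMap.ext fun v => ?_
  refine (congrArg (fun A : E₁ × E₂ →L[ℝ] E₁ × E₂ =>
    formAt (prodMetric g₁ g₂) ((extChartAt (I₁.prod I₂) x).symm y) (A u) (A v))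
    (mfderiv_extChartAt_symm_prod x hy.1 hy.2)).trans ?_
  simp only [sumForm, add_apply, pull_apply, chartMetric_apply]
  rfl

theorem eventually_differentiableAt_comp_symm {a : M₁ → ℝ} (ha : ContMDiff I₁ 𝓘(ℝ, ℝ) ∞ a)
    (x : M₁) : ∀ᶠ y in 𝓝 (extChartAt I₁ x x),
      DifferentiableAt ℝ (a ∘ (extChartAt I₁ x).symm) y := by
  filter_upwards [extChartAt_target_mem_nhds (I := I₁) x] with y hy
  exact (contDiffAt_comp_symm ha x hy).differentiableAt (by simp)

variable [FiniteDimensional ℝ E₁] [FiniteDimensional ℝ E₂]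

theorem isRegularAt_chartMetric (g : Metric I₁ M₁) (x : M₁) :
    IsRegularAt (chartMetric g x) (extChartAt I₁ x x) where
  contDiffAt := (contDiffAt_chartMetric g x (mem_extChartAt_target x)).of_le (by norm_cast)
  eventually_isInvertible := by
    filter_upwards [extChartAt_target_mem_nhds (I := I₁) x] with y hy
    exact isInvertible_chartMetric g x hy

theorem ricci_prodMetric (g₁ : Metric I₁ M₁) (g₂ : Metric I₂ M₂) (x : M₁ × M₂) :
    (ricci (prodMetric g₁ g₂) x : E₁ × E₂ →L[ℝ] E₁ × E₂)
      = (ricci g₁ x.1 : E₁ →L[ℝ] E₁).prodMap (ricci g₂ x.2 : E₂ →L[ℝ] E₂) :=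
  ricciEndo_eq_prodMap (z := (extChartAt I₁ x.1 x.1, extChartAt I₂ x.2 x.2))
    (isRegularAt_chartMetric g₁ x.1) (isRegularAt_chartMetric g₂ x.2)
    (chartMetric_prodMetric g₁ g₂ x)

theorem hessian_prodMetric_add (g₁ : Metric I₁ M₁) (g₂ : Metric I₂ M₂) {f : M₁ × M₂ → ℝ}
    {a : M₁ → ℝ} {b : M₂ → ℝ} (ha : ContMDiff I₁ 𝓘(ℝ, ℝ) ∞ a) (hb : ContMDiff I₂ 𝓘(ℝ, ℝ) ∞ b)
    (hf : ∀ p, f p = a p.1 + b p.2) (x : M₁ × M₂) :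
    (hessian (prodMetric g₁ g₂) f x : E₁ × E₂ →L[ℝ] E₁ × E₂)
      = (hessian g₁ a x.1 : E₁ →L[ℝ] E₁).prodMap (hessian g₂ b x.2 : E₂ →L[ℝ] E₂) :=
  covDeriv_gradient_eq_prodMap (z := (extChartAt I₁ x.1 x.1, extChartAt I₂ x.2 x.2))
    (isRegularAt_chartMetric g₁ x.1) (isRegularAt_chartMetric g₂ x.2)
    (chartMetric_prodMetric g₁ g₂ x) (eventually_differentiableAt_comp_symm ha x.1)
    (eventually_differentiableAt_comp_symm hb x.2)
    (.of_forall fun y => (comp_extChartAt_symm_prod f x y).trans (hf _))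
    (differentiableAt_gradient g₁ ha x.1 (mem_extChartAt_target x.1))
    (differentiableAt_gradient g₂ hb x.2 (mem_extChartAt_target x.2))

/-- If the mixed part of the Hessian of `f` vanishes, then the differential of `f` along `M₁` at
`(x₁, x₂)` does not depend on `x₂`. -/
theorem fderiv_fst_eq_of_hessian_mixed_eq_zero [PreconnectedSpace M₂]
    (g₁ : Metric I₁ M₁) (g₂ : Metric I₂ M₂) {f : M₁ × M₂ → ℝ}
    (hf : ContMDiff (I₁.prod I₂) 𝓘(ℝ, ℝ) ∞ f)
    (hmix : ∀ (x : M₁ × M₂) (u : E₂),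
      ((hessian (prodMetric g₁ g₂) f x : E₁ × E₂ →L[ℝ] E₁ × E₂) (0, u)).1 = 0)
    (x₁ : M₁) (x₂ x₂' : M₂) :
    fderiv ℝ (fun y => f ((extChartAt I₁ x₁).symm y, x₂)) (extChartAt I₁ x₁ x₁)
      = fderiv ℝ (fun y => f ((extChartAt I₁ x₁).symm y, x₂')) (extChartAt I₁ x₁ x₁) := by
  refine eq_of_hasFDerivAt_zero (I := I₂)
    (φ := fun x₂ => fderiv ℝ (fun y => f ((extChartAt I₁ x₁).symm y, x₂)) (extChartAt I₁ x₁ x₁))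
    (fun x₂ => ?_) x₂ x₂'
  set z : E₁ × E₂ := (extChartAt I₁ x₁ x₁, extChartAt I₂ x₂ x₂) with hz
  let F : E₁ × E₂ → ℝ := f ∘ (extChartAt (I₁.prod I₂) (x₁, x₂)).symm
  have key := hasFDerivAt_zero_of_covDeriv_gradient (z := z) (F := F)
    (isRegularAt_chartMetric g₁ x₁) (isRegularAt_chartMetric g₂ x₂)
    (chartMetric_prodMetric g₁ g₂ (x₁, x₂))
    (differentiableAt_gradient (prodMetric g₁ g₂) hf (x₁, x₂)
      (mem_extChartAt_target (I := I₁.prod I₂) (x₁, x₂)))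
    (hmix (x₁, x₂))
  have hd : ∀ᶠ y in 𝓝 z, DifferentiableAt ℝ F y :=
    eventually_differentiableAt_comp_symm (I₁ := I₁.prod I₂) hf (x₁, x₂)
  have hι : ContinuousAt (fun y : E₂ => (z.1, y)) z.2 := by fun_prop
  refine key.congr_of_eventuallyEq ?_
  filter_upwards [hι.eventually hd] with y hy
  have c : HasFDerivAt (fun y' : E₁ => F (y', y)) (fderiv ℝ F (z.1, y) ∘L inl ℝ E₁ E₂) z.1 :=
    HasFDerivAt.comp (f := fun y' : E₁ => (y', y)) z.1 hy.hasFDerivAt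
      (hasFDerivAt_prodMk_left z.1 y)
  simp only [F, comp_extChartAt_symm_prod] at c
  exact c.fderiv

/-- A function with vanishing mixed Hessian on a product of connected manifolds is the sum of a
function on `M₁` and a function on `M₂`: its increments in the second variable do not depend on the
first one. -/
theorem sub_eq_sub_of_hessian_mixed_eq_zero [PreconnectedSpace M₁] [PreconnectedSpace M₂]
    (g₁ : Metric I₁ M₁) (g₂ : Metric I₂ M₂) {f : M₁ × M₂ → ℝ}
    (hf : ContMDiff (I₁.prod I₂) 𝓘(ℝ, ℝ) ∞ f)
    (hmix : ∀ (x : M₁ × M₂) (u : E₂),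
      ((hessian (prodMetric g₁ g₂) f x : E₁ × E₂ →L[ℝ] E₁ × E₂) (0, u)).1 = 0)
    (x₁ x₁' : M₁) (x₂ x₂' : M₂) :
    f (x₁, x₂) - f (x₁, x₂') = f (x₁', x₂) - f (x₁', x₂') := by
  refine eq_of_hasFDerivAt_zero (I := I₁) (φ := fun x₁ => f (x₁, x₂) - f (x₁, x₂'))
    (fun x₁ => ?_) x₁ x₁'
  have hs : ∀ q : M₂, DifferentiableAt ℝ (fun y => f ((extChartAt I₁ x₁).symm y, q))
      (extChartAt I₁ x₁ x₁) := fun q =>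
    (contDiffAt_comp_symm (hf.comp (contMDiff_id.prodMk contMDiff_const)) x₁
      (mem_extChartAt_target x₁)).differentiableAt (by simp)
  have h := (hs x₂).hasFDerivAt.sub (hs x₂').hasFDerivAt
  rwa [fderiv_fst_eq_of_hessian_mixed_eq_zero g₁ g₂ hf hmix x₁ x₂ x₂', sub_self] at h

/-! ### Solutions of the generalised Ricci-Hessian equation on a product -/

/-- For `f = a + b` the equation splits into one equation on each factor, both involving the sum
`a + b` on the right-hand side. -/
theorem isSolution_prodMetric_iff (g₁ : Metric I₁ M₁) (g₂ : Metric I₂ M₂) {f : M₁ × M₂ → ℝ}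
    {a : M₁ → ℝ} {b : M₂ → ℝ} (ha : ContMDiff I₁ 𝓘(ℝ, ℝ) ∞ a) (hb : ContMDiff I₂ 𝓘(ℝ, ℝ) ∞ b)
    (hf : ∀ p, f p = a p.1 + b p.2) :
    IsSolution (prodMetric g₁ g₂) f ↔ ∀ (x₁ : M₁) (x₂ : M₂),
      hessian g₁ a x₁ = -(a x₁ + b x₂) • ricci g₁ x₁ ∧
        hessian g₂ b x₂ = -(a x₁ + b x₂) • ricci g₂ x₂ := by
  unfold IsSolution
  rw [Prod.forall]
  refine forall₂_congr fun x₁ x₂ => ?_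
  have hH := hessian_prodMetric_add g₁ g₂ ha hb hf (x₁, x₂)
  have hR := ricci_prodMetric g₁ g₂ (x₁, x₂)
  constructor
  · intro h
    have h' : ∀ u : E₁ × E₂, (hessian (prodMetric g₁ g₂) f (x₁, x₂) : E₁ × E₂ →L[ℝ] E₁ × E₂) u
        = -(f (x₁, x₂)) • (ricci (prodMetric g₁ g₂) (x₁, x₂) : E₁ × E₂ →L[ℝ] E₁ × E₂) u :=
      fun u => by rw [h]; rfl
    rw [hH, hR, hf] at h'
    exact ⟨ContinuousLinearMap.ext fun u => congrArg Prod.fst (h' (u, (0 : E₂))),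
      ContinuousLinearMap.ext fun u => congrArg Prod.snd (h' ((0 : E₁), u))⟩
  · rintro ⟨h₁, h₂⟩
    refine ContinuousLinearMap.ext fun u => ?_
    refine (congrArg (fun L : E₁ × E₂ →L[ℝ] E₁ × E₂ => L u) hH).trans ?_
    refine Eq.trans ?_
      (congrArg (fun L : E₁ × E₂ →L[ℝ] E₁ × E₂ => -(f (x₁, x₂)) • L u) hR).symm
    rw [hf]
    exact Prod.ext (congrArg (fun L => L u.1) h₁) (congrArg (fun L => L u.2) h₂)

theorem isSolution_prodMetric_snd_iff [Nonempty M₁] (g₁ : Metric I₁ M₁) (g₂ : Metric I₂ M₂)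
    {f : M₁ × M₂ → ℝ} {h : M₂ → ℝ} (hh : ContMDiff I₂ 𝓘(ℝ, ℝ) ∞ h) (hf : ∀ p, f p = h p.2) :
    IsSolution (prodMetric g₁ g₂) f ↔
      (∀ (x₁ : M₁) (x₂ : M₂), h x₂ = 0 ∨ ricci g₁ x₁ = 0) ∧ IsSolution g₂ h := by
  rw [isSolution_prodMetric_iff g₁ g₂ (a := 0) contMDiff_const hh (by simpa using hf)]
  simp only [hessian_zero, Pi.zero_apply, zero_add, forall_and]
  refine and_congr (forall₂_congr fun x₁ x₂ => ?_) (by simp [IsSolution])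
  rw [eq_comm, smul_eq_zero, neg_eq_zero]

/-- If `g₂` is not Ricci-flat, solutions on the product do not depend on the first factor. -/
theorem eq_of_isSolution_prodMetric [PreconnectedSpace M₁] [PreconnectedSpace M₂]
    (g₁ : Metric I₁ M₁) (g₂ : Metric I₂ M₂) (hRic : ricci g₂ ≠ 0) {f : M₁ × M₂ → ℝ}
    (hf : ContMDiff (I₁.prod I₂) 𝓘(ℝ, ℝ) ∞ f) (hs : IsSolution (prodMetric g₁ g₂) f)
    (x₁ x₁' : M₁) (x₂ : M₂) : f (x₁, x₂) = f (x₁', x₂) := by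
  -- the Ricci tensor of the product has no mixed part
  have hmix : ∀ (x : M₁ × M₂) (u : E₂),
      ((hessian (prodMetric g₁ g₂) f x : E₁ × E₂ →L[ℝ] E₁ × E₂) (0, u)).1 = 0 := by
    intro x u
    have h : (hessian (prodMetric g₁ g₂) f x : E₁ × E₂ →L[ℝ] E₁ × E₂)
        = -(f x) • (ricci (prodMetric g₁ g₂) x : E₁ × E₂ →L[ℝ] E₁ × E₂) := hs x
    refine (congrArg (fun L : E₁ × E₂ →L[ℝ] E₁ × E₂ => (L (0, u)).1) (h.trans
      (congrArg (fun L : E₁ × E₂ →L[ℝ] E₁ × E₂ => -(f x) • L)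
        (ricci_prodMetric g₁ g₂ x)))).trans ?_
    have h0 : ∀ R : E₁ →L[ℝ] E₁, -(f x) • R 0 = 0 := fun R => by rw [map_zero, smul_zero]
    exact h0 (ricci g₁ x.1)
  have hsub := sub_eq_sub_of_hessian_mixed_eq_zero g₁ g₂ hf hmix
  obtain ⟨q, hq⟩ := Function.ne_iff.1 hRic
  -- the splitting `f = a + b` with `b q = 0`
  have ha : ContMDiff I₁ 𝓘(ℝ, ℝ) ∞ fun p => f (p, q) :=
    hf.comp (contMDiff_id.prodMk contMDiff_const)
  have hb : ContMDiff I₂ 𝓘(ℝ, ℝ) ∞ fun p => f (x₁, p) - f (x₁, q) :=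
    (hf.comp (contMDiff_const.prodMk contMDiff_id)).sub contMDiff_const
  have h := (isSolution_prodMetric_iff g₁ g₂ ha hb
    fun p => by linarith [hsub p.1 x₁ p.2 q]).1 hs
  -- at `q` the Hessian of `b` equals `-(a(p) + b(q)) • Ric₂ = -a(p) • Ric₂` for every `p`
  have e := (h x₁ q).2.symm.trans (h x₁' q).2
  have e' := smul_left_injective ℝ hq e
  simp only [sub_self, add_zero, neg_inj] at e'
  linarith [hsub x₁ x₁' x₂ q]

end Product

end RicciHessian


theorem mainTheorem8
    {E₁ : Type*} [NormedAddCommGroup E₁] [NormedSpace ℝ E₁] [FiniteDimensional ℝ E₁]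
    {H₁ : Type*} [TopologicalSpace H₁] {I₁ : ModelWithCorners ℝ E₁ H₁} [I₁.Boundaryless]
    {M₁ : Type*} [TopologicalSpace M₁] [ChartedSpace H₁ M₁] [IsManifold I₁ ∞ M₁]
    [ConnectedSpace M₁]
    {E₂ : Type*} [NormedAddCommGroup E₂] [NormedSpace ℝ E₂] [FiniteDimensional ℝ E₂]
    {H₂ : Type*} [TopologicalSpace H₂] {I₂ : ModelWithCorners ℝ E₂ H₂} [I₂.Boundaryless]
    {M₂ : Type*} [TopologicalSpace M₂] [ChartedSpace H₂ M₂] [IsManifold I₂ ∞ M₂]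
    [ConnectedSpace M₂]
    (g₁ : RicciHessian.Metric I₁ M₁) (g₂ : RicciHessian.Metric I₂ M₂)
    (hRic : RicciHessian.ricci g₂ ≠ 0) :
    (∀ f : C^∞⟮I₁.prod I₂, M₁ × M₂; ℝ⟯, f ≠ 0 →
      (RicciHessian.IsSolution (RicciHessian.prodMetric g₁ g₂) f ↔
        RicciHessian.ricci g₁ = 0 ∧
          ∃ h : C^∞⟮I₂, M₂; ℝ⟯, (∀ p : M₁ × M₂, f p = h p.2) ∧ RicciHessian.IsSolution g₂ h)) ∧
    ((∃ e : RicciHessian.W g₂ ≃ₗ[ℝ] RicciHessian.W (RicciHessian.prodMetric g₁ g₂),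
        ∀ (h : RicciHessian.W g₂) (p : M₁ × M₂), (e h).1 p = h.1 p.2) ↔
      RicciHessian.ricci g₁ = 0 ∨ RicciHessian.W g₂ = ⊥) := by
  have part₁ : ∀ f : C^∞⟮I₁.prod I₂, M₁ × M₂; ℝ⟯, f ≠ 0 →
      (RicciHessian.IsSolution (RicciHessian.prodMetric g₁ g₂) f ↔
        RicciHessian.ricci g₁ = 0 ∧
          ∃ h : C^∞⟮I₂, M₂; ℝ⟯, (∀ p : M₁ × M₂, f p = h p.2) ∧
            RicciHessian.IsSolution g₂ h) := by
    intro f hf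
    constructor
    · intro hs
      obtain ⟨p₀⟩ : Nonempty M₁ := inferInstance
      let h : C^∞⟮I₂, M₂; ℝ⟯ :=
        ⟨fun p => f (p₀, p), f.contMDiff.comp (contMDiff_const.prodMk contMDiff_id)⟩
      have hfh : ∀ p : M₁ × M₂, f p = h p.2 := fun p =>
        RicciHessian.eq_of_isSolution_prodMetric g₁ g₂ hRic f.contMDiff hs p.1 p₀ p.2
      obtain ⟨h0, hh⟩ :=
        (RicciHessian.isSolution_prodMetric_snd_iff g₁ g₂ h.contMDiff hfh).1 hs
      obtain ⟨p, hp⟩ := DFunLike.ne_iff.1 hf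
      exact ⟨funext fun x₁ => (h0 x₁ p.2).resolve_left (hfh p ▸ hp), h, hfh, hh⟩
    · rintro ⟨hR, h, hfh, hh⟩
      exact (RicciHessian.isSolution_prodMetric_snd_iff g₁ g₂ h.contMDiff hfh).2
        ⟨fun x₁ _ => .inr (congrFun hR x₁), hh⟩
  refine ⟨part₁, ?_, ?_⟩
  · rintro ⟨e, -⟩
    by_contra! hcon
    have := Submodule.nontrivial_iff_ne_bot.2 hcon.2
    obtain ⟨h, hne⟩ := exists_ne (0 : RicciHessian.W g₂)
    have hne' : (e h).1 ≠ 0 := fun h0 => hne (e.map_eq_zero_iff.1 (Subtype.ext h0))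
    exact hcon.1 ((part₁ _ hne').1 (e h).2).1
  · intro hor
    obtain ⟨p₀⟩ : Nonempty M₁ := inferInstance
    let extend : C^∞⟮I₂, M₂; ℝ⟯ →ₗ[ℝ] C^∞⟮I₁.prod I₂, M₁ × M₂; ℝ⟯ :=
      { toFun := fun h => h.comp ⟨Prod.snd, contMDiff_snd⟩
        map_add' := fun _ _ => rfl
        map_smul' := fun _ _ => rfl }
    have hmem : ∀ h ∈ RicciHessian.W g₂, extend h ∈
        RicciHessian.W (RicciHessian.prodMetric g₁ g₂) := by
      intro h hh
      refine (RicciHessian.isSolution_prodMetric_snd_iff g₁ g₂ h.contMDiff fun _ => rfl).2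
        ⟨fun x₁ x₂ => ?_, hh⟩
      rcases hor with hR | hW
      · exact .inr (congrFun hR x₁)
      · rw [hW, Submodule.mem_bot] at hh
        exact .inl (by rw [hh]; rfl)
    refine ⟨.ofBijective (extend.restrict hmem) ⟨fun h h' e => ?_, fun f => ?_⟩, fun h p => rfl⟩
    · ext p
      exact congrArg (fun k => k.1 (p₀, p)) e
    · by_cases hf : f.1 = 0
      · exact ⟨0, (map_zero _).trans (Subtype.ext hf.symm)⟩
      · obtain ⟨-, h, hfh, hh⟩ := (part₁ f.1 hf).1 f.2
        exact ⟨⟨h, hh⟩, Subtype.ext (ContMDiffMap.ext fun p => (hfh p).symm)⟩
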